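/- Let $\mathcal V$ be a finite vocabulary, $T$ a horizon, and let the draft model $p$ and the target model $q$ give conditional next-token distributions $p(\cdot\mid x_{1:n-1})$, $q(\cdot\mid x_{1:n-1})$ on $\mathcal V$ for all contexts $x_{1:n-1}$ (the prompt is fixed, and $x_{1:0}$ denotes the empty context). Put $q(x_{1:n})=\prod_{i=1}^n q(x_i\mid x_{1:i-1})$, $q(x_{1:0})=1$, $h(a\mid x_{1:n-1})=\max\{0,q(a\mid x_{1:n-1})-p(a\mid x_{1:n-1})\}$, let $[q-p]_+$ be the normalization of $\max\{0,q-p\}$ to a probability distribution, and let $\mathsf{TV}(q,p)(x_{1:n-1})$ be the total variation distance of $q(\cdot\mid x_{1:n-1})$ and $p(\cdot\mid x_{1:n-1})$. Batch speculative decoding with batch size $M$ generates $x_1,\dots,x_T$ as follows. While only $x_{1:n-1}$ with $n-1<T$ has been generated, it samples $M$ independent draft responses $\tilde x^m_{n:T}$, $m=1,\dots,M$, autoregressively from $p$. With $q^1=q(\cdot\mid x_{1:n-1})$, it tests the first tokens $\tilde x^m_n$ for $m=1,2,\dots$: it accepts $\tilde x^m_n$ with probability $\min\{1,q^m(\tilde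 x^m_n)/p(\tilde x^m_n\mid x_{1:n-1})\}$, and otherwise sets $q^{m+1}=[q^m-p(\cdot\mid x_{1:n-1})]_+$ and goes on to the next response. If all $M$ first tokens fail, the $n$-th token is *rejected* and $x_n$ is sampled from $q^{M+1}$. If some $\tilde x^m_n$ is accepted, the later tokens $\tilde x^m_t$ of that response alone are tested one after the other, each being accepted with probability $\min\{1,q(\tilde x^m_t\mid x_{1:t-1})/p(\tilde x^m_t\mid x_{1:t-1})\}$; at the first failure the $t$-th token is *rejected* and $x_t$ is sampled from $[q-p]_+(\cdot\mid x_{1:t-1})$. After a rejection the procedure restarts with a fresh batch. Let $N_{\mathrm{rej}}$ be the number of $n\in\{1,\dots,T\}$ whose token is rejected, and let $f^M(x_{1:n})$ be the probability that the first $n$ output tokens are $x_{1:n}$ and the $n$-th token is rejected; for $n=0$ put $f^M(x_{1:0})=1$. **Proposition.** 1. $f^M(x_{1:n})\le q(x_{1:n})$ for all $M$ and $x_{1:n}$; the limit $f^\infty(x_{1:n})=\lim_{M\to\infty}f^M(x_{1:n})$ exists, and $f^\infty(x_{1:n})\le q(x_{1:n})$. Suppose for items 2 and 3 that the draft model covers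 the target model: whenever $n\le T$, $q(x_{1:n-1})>0$ and $q(x_n\mid x_{1:n-1})>0$, also $p(x_n\mid x_{1:n-1})>0$. 2. $f^\infty(x_{1:n})=h(x_n\mid x_{1:n-1})\,[q(x_{1:n-1})-f^\infty(x_{1:n-1})]$ for $1\le n\le T$. 3. $\displaystyle\lim_{M\to\infty}\mathbb E[N_{\mathrm{rej}}]=\sum_{n=1}^T\Big(\sum_{x_{1:n-1}}q(x_{1:n-1})\,\mathsf{TV}(q,p)(x_{1:n-1})-\sum_{x_{1:n-1}}f^\infty(x_{1:n-1})\,\mathsf{TV}(q,p)(x_{1:n-1})\Big).$ 4. (Without the covering assumption.) If the two models differ at some nonempty context that the target model can produce, i.e. $p(\cdot\mid x_{1:k})\ne q(\cdot\mid x_{1:k})$ for some $1\le k<T$ and some $x_{1:k}$ with $q(x_{1:k})>0$, then $\mathbb E[N_{\mathrm{rej}}]$ does not tend to $0$ as $M\to\infty$. -/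

import Mathlib

open Filter Topology
open scoped ENNReal NNReal

noncomputable section

namespace BatchSD

/-- The distribution `[q - p]_+`, i.e. `max {0, q - p}` normalized to total mass one (subtraction in
`ℝ≥0∞` is truncated at zero). If `max {0, q - p}` vanishes identically, that is if `q = p`, then a
draft token is rejected with probability zero, and the value chosen here plays no role. -/
def residual {V : Type*} [Fintype V] (q p : PMF V) : PMF V :=
  open Classical in
  if h : (∑' a, (q a - p a)) ≠ 0 then
    PMF.normalize (fun a => q a - p a) h
      (ne_top_of_le_ne_top q.tsum_coe_ne_top (ENNReal.tsum_le_tsum fun _ => tsub_le_self))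
  else q

/-- The coin of the test `r ≤ min {1, q(a) / p(a)}` with `r` uniform on `[0, 1]`:
`true` means that the draft token `a` is accepted. -/
def acceptCoin {V : Type*} (q p : PMF V) (a : V) : PMF Bool :=
  PMF.ofFintype (fun b => if b then min 1 (q a / p a) else 1 - min 1 (q a / p a))
    (by simp [add_tsub_cancel_of_le])

/-- One draft response: `k` tokens sampled one after the other from the draft model `p`, starting
from the context `x`. -/
def draft {V : Type*} (p : List V → PMF V) : ℕ → List V → PMF (List V)
  | 0, _ => PMF.pure []
  | k + 1, x => (p x).bind fun a => (draft p k (x ++ [a])).bind fun l => PMF.pure (a :: l)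

/-- `M` independent draft responses with `k` tokens each, from the context `x`. -/
def draftBatch {V : Type*} (p : List V → PMF V) (k : ℕ) (x : List V) : ℕ → PMF (List (List V))
  | 0 => PMF.pure []
  | M + 1 => (draft p k x).bind fun d => (draftBatch p k x M).bind fun ds => PMF.pure (d :: ds)

/-- Verification of the tokens of a response after its first token, in the context `x`. The output
lists the new tokens, each with a flag which is `true` if the token comes from a rejection step.
At the first rejection the replacement token is sampled from `[q - p]_+` and verification stops. -/
def verifyTail {V : Type*} [Fintype V] (p q : List V → PMF V) :
    List V → List V → PMF (List (V × Bool))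
  | _, [] => PMF.pure []
  | x, a :: l =>
      (acceptCoin (q x) (p x) a).bind fun acc =>
        if acc then (verifyTail p q (x ++ [a]) l).bind fun s => PMF.pure ((a, false) :: s)
        else (residual (q x) (p x)).bind fun y => PMF.pure [(y, true)]

/-- Verification of a batch of responses in the context `x`. The argument `r` is the current
distribution `q^m` at the root: it starts as `q^1 = q` and is replaced by `q^{m+1} = [q^m - p]_+`
whenever the first token of the `m`-th response fails. If the first token of a response is accepted,
only that response is verified further. If the first tokens of all `M` responses fail, this is a
rejection, and the token is sampled from `q^{M+1}`. -/
def verifyBatch {V : Type*} [Fintype V] (p q : List V → PMF V) (x : List V) :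
    PMF V → List (List V) → PMF (List (V × Bool))
  | r, [] => r.bind fun y => PMF.pure [(y, true)]
  | _, [] :: _ => PMF.pure []
  | r, (a :: l) :: ds =>
      (acceptCoin r (p x) a).bind fun acc =>
        if acc then (verifyTail p q (x ++ [a]) l).bind fun s => PMF.pure ((a, false) :: s)
        else verifyBatch p q x (residual r (p x)) ds

/-- One pass of the outer loop `while n < T`: draft `M` responses up to the horizon `T`, verify them,
and append the tokens obtained to the tokens `s` that are already there. -/
def pass {V : Type*} [Fintype V] (p q : List V → PMF V) (M T : ℕ) (s : List (V × Bool)) :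
    PMF (List (V × Bool)) :=
  if s.length < T then
    (draftBatch p (T - s.length) (s.map Prod.fst) M).bind fun ds =>
      (verifyBatch p q (s.map Prod.fst) (q (s.map Prod.fst)) ds).bind fun o => PMF.pure (s ++ o)
  else PMF.pure s

/-- `k` passes of the outer loop, started in `s`. -/
def passes {V : Type*} [Fintype V] (p q : List V → PMF V) (M T : ℕ) :
    ℕ → List (V × Bool) → PMF (List (V × Bool))
  | 0, s => PMF.pure s
  | k + 1, s => (pass p q M T s).bind (passes p q M T k)

/-- The law of the output of batch speculative decoding with draft model `p`, target model `q`, batch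
size `M` and horizon `T`: the tokens `x_1, …, x_T` with the flags `R_1, …, R_T`, where `R_n` is `true`
if the `n`-th token was rejected. Every pass yields at least one new token as long as fewer than `T`
tokens are there, and afterwards a pass does nothing, so that `T` passes complete the loop. -/
def law {V : Type*} [Fintype V] (p q : List V → PMF V) (M T : ℕ) : PMF (List (V × Bool)) :=
  passes p q M T T []

/-- The expectation of the number of rejections `N_rej = R_1 + ⋯ + R_T`. -/
def expectedRejections {V : Type*} [Fintype V] (p q : List V → PMF V) (M T : ℕ) : ℝ :=
  (∑' s, law p q M T s * (s.countP Prod.snd : ℝ≥0∞)).toReal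

/-- `f^M(x_{1:n})`, the probability that the first `n` output tokens are `x_{1:n}` and that the `n`-th
draft token is rejected. For `n = 0` the second condition is void, so that the value at the prompt is
`1`: like a rejection, the start of the decoding is followed by a fresh batch. -/
def rejMass {V : Type*} [Fintype V] (p q : List V → PMF V) (T M : ℕ) (x : List V) : ℝ :=
  ((law p q M T).toOuterMeasure
    {s | (s.take x.length).map Prod.fst = x ∧
      ∀ b ∈ (s.take x.length).getLast?, b.2 = true}).toReal

/-- The product of the conditional probabilities of the tokens of the second list, given the context
that is the first list. -/
def condProb {V : Type*} (q : List V → PMF V) : List V → List V → ℝ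
  | _, [] => 1
  | c, a :: l => (q c a).toReal * condProb q (c ++ [a]) l

/-- The joint probability `q(x_{1:n}) = ∏ q(x_i | x_{1:i-1})`. -/
def jointProb {V : Type*} (q : List V → PMF V) (x : List V) : ℝ := condProb q [] x

/-- The total variation distance of two distributions on the vocabulary. -/
def tv {V : Type*} [Fintype V] (q p : PMF V) : ℝ :=
  (1 / 2) * ∑ a, |(q a).toReal - (p a).toReal|

/-- `h(a | x) = max {0, q(a | x) - p(a | x)}`. -/
def excess {V : Type*} (p q : List V → PMF V) (x : List V) (a : V) : ℝ :=
  max 0 ((q x a).toReal - (p x a).toReal)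

/-- The sum `∑ μ(x_{1:k}) g(x_{1:k})` over all `x_{1:k}`, for a pseudo-measure `μ`. -/
def pseudoExp {V : Type*} [Fintype V] (μ : List V → ℝ) (k : ℕ) (g : List V → ℝ) : ℝ :=
  ∑ x : Fin k → V, μ (List.ofFn x) * g (List.ofFn x)

end BatchSD

end

noncomputable section

namespace BatchSD

/-! Reveal each draft token only when it is tested. The decoding then becomes a Markov chain adding
one token at a time, and the next step depends on the past only through the tokens and on whether
the last one was rejected (`expect_passes`, `expect_law`). At the start or after a rejection, the
next token is `a` and rejected with probability `R_M(a)` (`rootRej`); after an acceptance, with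
probability `h(a)`. In both cases accepted and rejected mass at `a` add up to `q(a)`, so the tokens
follow the target model and `f^M(xa) = f^M(x) R_M(a) + (q(x) - f^M(x)) h(a)` (`rejMass_concat`).

`R_M(a)` decreases in `M`, so the limits exist by induction on the prefix. Each further response
multiplies it by at most `1 - p(a)` (`rootRej_le_pow`); under covering the first term of the
recursion therefore disappears, which is item 2. Summing over `a` turns `h` into the total variation
distance and gives item 3.

For item 4, if the expectation tends to `0`, then `f^∞` vanishes on all nonempty prefixes up to the
horizon. The recursion at `x` leaves `q(x) h(a) = 0` for all `a`, so the two models agree at `x`. -/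

/-- The expectation of a nonnegative function under a probability mass function. -/
def expect {α : Type*} (μ : PMF α) (φ : α → ℝ≥0∞) : ℝ≥0∞ := ∑' a, μ a * φ a

section Expect

variable {α β : Type*}

lemma expect_pure (a : α) (φ : α → ℝ≥0∞) : expect (PMF.pure a) φ = φ a := by
  unfold expect
  rw [tsum_eq_single a]
  · simp
  · intro b hb
    simp [PMF.pure_apply, hb]

lemma expect_bind (μ : PMF α) (f : α → PMF β) (φ : β → ℝ≥0∞) :
    expect (μ.bind f) φ = expect μ fun a => expect (f a) φ := by
  simp only [expect, PMF.bind_apply, ← ENNReal.tsum_mul_right, ← ENNReal.tsum_mul_left]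
  rw [ENNReal.tsum_comm]
  simp only [mul_assoc]

lemma expect_const (μ : PMF α) (c : ℝ≥0∞) : expect μ (fun _ => c) = c := by
  simp [expect, ENNReal.tsum_mul_right]

lemma expect_add (μ : PMF α) (φ ψ : α → ℝ≥0∞) :
    expect μ (fun a => φ a + ψ a) = expect μ φ + expect μ ψ := by
  simp only [expect, mul_add, ENNReal.tsum_add]

lemma expect_const_mul (μ : PMF α) (c : ℝ≥0∞) (φ : α → ℝ≥0∞) :
    expect μ (fun a => c * φ a) = c * expect μ φ := by
  simp only [expect, mul_left_comm _ c, ENNReal.tsum_mul_left]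

lemma expect_eq_sum [Fintype α] (μ : PMF α) (φ : α → ℝ≥0∞) :
    expect μ φ = ∑ a, μ a * φ a := tsum_fintype _

lemma sum_pmf [Fintype α] (μ : PMF α) : ∑ a, μ a = 1 := by
  rw [← tsum_fintype (L := .unconditional _), μ.tsum_coe]

end Expect

/-! ### A single accept/reject test. -/

variable {V : Type*}

lemma min_add_tsub (a b : ℝ≥0∞) : min a b + (b - a) = b := by
  rcases le_total a b with h | h
  · rw [min_eq_left h, add_tsub_cancel_of_le h]
  · rw [min_eq_right h, tsub_eq_zero_of_le h, add_zero]

lemma mul_accept (r p : PMF V) (a : V) : p a * min 1 (r a / p a) = min (p a) (r a) := by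
  by_cases h : p a = 0
  · simp [h]
  · rw [mul_min, mul_one, ENNReal.mul_div_cancel h (p.apply_ne_top a)]

lemma expect_acceptCoin (r p : PMF V) (a : V) (φ : Bool → ℝ≥0∞) :
    expect (acceptCoin r p a) φ =
      min 1 (r a / p a) * φ true + (1 - min 1 (r a / p a)) * φ false := by
  simp [expect_eq_sum, acceptCoin]

/-- The state after which a fresh batch is drawn: nothing has been generated, or the last token comes
from a rejection. -/
def Fresh (s : List (V × Bool)) : Prop := ∀ b ∈ s.getLast?, b.2 = true

lemma fresh_nil : Fresh ([] : List (V × Bool)) := by simp [Fresh]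

lemma fresh_concat (s : List (V × Bool)) (a : V) (b : Bool) : Fresh (s ++ [(a, b)]) ↔ b = true := by
  simp [Fresh]

variable [Fintype V]

/-- The probability that a draft token from `p` fails the test against `r`. -/
def gap (r p : PMF V) : ℝ≥0∞ := ∑ a, (r a - p a)

lemma sum_min_add_gap (r p : PMF V) : ∑ a, min (p a) (r a) + gap r p = 1 := by
  rw [gap, ← Finset.sum_add_distrib, ← sum_pmf r]
  exact Finset.sum_congr rfl fun a _ => min_add_tsub _ _

lemma gap_le_one (r p : PMF V) : gap r p ≤ 1 := by
  rw [← sum_min_add_gap r p]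
  exact le_add_self

lemma gap_ne_top (r p : PMF V) : gap r p ≠ ∞ :=
  ne_top_of_le_ne_top ENNReal.one_ne_top (gap_le_one r p)

/-- Both sides are one minus the accepted mass `∑ min (p a) (r a)`: the left because `p` has mass
one, the right because `r` has. -/
lemma sum_mul_reject (r p : PMF V) : ∑ a, p a * (1 - min 1 (r a / p a)) = gap r p := by
  have h1 : ∑ a, min (p a) (r a) + ∑ a, p a * (1 - min 1 (r a / p a)) = 1 := by
    rw [← Finset.sum_add_distrib]
    refine Eq.trans ?_ (sum_pmf p)
    refine Finset.sum_congr rfl fun a _ => ?_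
    rw [← mul_accept r p a, ← mul_add, add_tsub_cancel_of_le (min_le_left _ _), mul_one]
  have h2 : ∑ a, min (p a) (r a) ≠ ∞ :=
    ne_top_of_le_ne_top ENNReal.one_ne_top (h1 ▸ le_self_add)
  exact (ENNReal.add_right_inj h2).1 (h1.trans (sum_min_add_gap r p).symm)

lemma gap_mul_residual (r p : PMF V) (a : V) : gap r p * residual r p a = r a - p a := by
  have hg : ∑' a, (r a - p a) = gap r p := tsum_fintype _
  by_cases h : (∑' a, (r a - p a)) ≠ 0
  · rw [residual, dif_pos h, PMF.normalize_apply, hg, mul_left_comm,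
      ENNReal.mul_inv_cancel (hg ▸ h) (gap_ne_top r p), mul_one]
  -- Here `residual` has its default value, which the factor `gap r p = 0` hides.
  · rw [not_not] at h
    have h0 : r a - p a = 0 := ENNReal.tsum_eq_zero.1 h a
    rw [← hg, h, zero_mul, h0]

/-- One test of a draft token: it is `a` and accepted with probability `min (p a) (r a)`, and it
fails with probability `gap r p`. -/
lemma sum_test (r p : PMF V) (φ : V → ℝ≥0∞) (c : ℝ≥0∞) :
    ∑ a, p a * (min 1 (r a / p a) * φ a + (1 - min 1 (r a / p a)) * c) =
      ∑ a, min (p a) (r a) * φ a + gap r p * c := by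
  rw [← sum_mul_reject, Finset.sum_mul, ← Finset.sum_add_distrib]
  refine Finset.sum_congr rfl fun a _ => ?_
  rw [mul_add, ← mul_assoc, mul_accept, mul_assoc]

/-! ### Testing the first tokens of a batch. -/

/-- The probability that `M` first tokens from `p` fail, with initial root distribution `r`, and that
the replacement token is `a`. -/
def rootRej (p : PMF V) : ℕ → PMF V → V → ℝ≥0∞
  | 0, r, a => r a
  | M + 1, r, a => gap r p * rootRej p M (residual r p) a

/-- The probability that one of `M` first tokens from `p` is accepted, with initial root
distribution `r`, and equals `a`. -/
def rootAcc (p : PMF V) : ℕ → PMF V → V → ℝ≥0∞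
  | 0, _, _ => 0
  | M + 1, r, a => min (p a) (r a) + gap r p * rootAcc p M (residual r p) a

lemma rootAcc_add_rootRej (p : PMF V) (M : ℕ) (r : PMF V) (a : V) :
    rootAcc p M r a + rootRej p M r a = r a := by
  induction M generalizing r with
  | zero => simp [rootAcc, rootRej]
  | succ M ih => rw [rootAcc, rootRej, add_assoc, ← mul_add, ih, gap_mul_residual, min_add_tsub]

lemma rootRej_le (p : PMF V) (M : ℕ) (r : PMF V) (a : V) : rootRej p M r a ≤ r a := by
  rw [← rootAcc_add_rootRej p M r a]
  exact le_add_self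

lemma rootRej_ne_top (p : PMF V) (M : ℕ) (r : PMF V) (a : V) : rootRej p M r a ≠ ∞ :=
  ne_top_of_le_ne_top (r.apply_ne_top a) (rootRej_le p M r a)

lemma rootRej_succ_le (p : PMF V) (M : ℕ) (r : PMF V) (a : V) :
    rootRej p (M + 1) r a ≤ rootRej p M r a := by
  induction M generalizing r with
  | zero =>
    rw [rootRej, rootRej, rootRej, gap_mul_residual]
    exact tsub_le_self
  | succ M ih =>
    exact mul_le_mul_right (ih _) (gap r p)

/-- In terms of the unnormalized root distributions, a further response subtracts the draft
distribution, scaled to the same mass. -/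
lemma rootRej_succ (p : PMF V) (M : ℕ) (r : PMF V) (a : V) :
    rootRej p (M + 1) r a = rootRej p M r a - (∑ b, rootRej p M r b) * p a := by
  induction M generalizing r with
  | zero => simp only [rootRej, gap_mul_residual, sum_pmf, one_mul]
  | succ M ih =>
    -- The recursion peels off the first response, the claim the last one; the common factor `gap r
    -- p` passes through the truncated subtraction because it is finite.
    rw [rootRej, ih, ENNReal.mul_sub fun _ _ => gap_ne_top r p]
    simp only [rootRej, ← Finset.mul_sum, mul_assoc]

/-- The mass subtracted at `a` is the total mass times `p a`, and the total is at least the mass at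
`a`. -/
lemma rootRej_le_pow (p : PMF V) (M : ℕ) (r : PMF V) (a : V) :
    rootRej p M r a ≤ (1 - p a) ^ M := by
  induction M with
  | zero => simpa [rootRej] using r.coe_le_one a
  | succ M ih =>
    calc rootRej p (M + 1) r a
        = rootRej p M r a - (∑ b, rootRej p M r b) * p a := rootRej_succ p M r a
      _ ≤ rootRej p M r a - rootRej p M r a * p a := by
          gcongr
          exact Finset.single_le_sum (f := rootRej p M r) (fun _ _ => zero_le) (Finset.mem_univ a)
      _ = rootRej p M r a * (1 - p a) := by
          rw [ENNReal.mul_sub fun _ _ => rootRej_ne_top p M r a, mul_one]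
      _ ≤ (1 - p a) ^ (M + 1) := by
          rw [pow_succ]
          gcongr

/-! ### Decoding as a one-token Markov chain. -/

open Classical in
/-- The probability that the token after `s` is `a` and rejected. -/
def stepRej (p q : List V → PMF V) (M : ℕ) (s : List (V × Bool)) (a : V) : ℝ≥0∞ :=
  if Fresh s then rootRej (p (s.map Prod.fst)) M (q (s.map Prod.fst)) a
  else q (s.map Prod.fst) a - p (s.map Prod.fst) a

open Classical in
/-- The probability that the token after `s` is `a` and accepted. -/
def stepAcc (p q : List V → PMF V) (M : ℕ) (s : List (V × Bool)) (a : V) : ℝ≥0∞ :=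
  if Fresh s then rootAcc (p (s.map Prod.fst)) M (q (s.map Prod.fst)) a
  else min (p (s.map Prod.fst) a) (q (s.map Prod.fst) a)

lemma stepAcc_add_stepRej (p q : List V → PMF V) (M : ℕ) (s : List (V × Bool)) (a : V) :
    stepAcc p q M s a + stepRej p q M s a = q (s.map Prod.fst) a := by
  unfold stepAcc stepRej
  split_ifs
  · exact rootAcc_add_rootRej _ _ _ _
  · exact min_add_tsub _ _

/-- The transition operator of the decoding, viewed as a Markov chain that adds one token. -/
def step (p q : List V → PMF V) (M : ℕ) (φ : List (V × Bool) → ℝ≥0∞) (s : List (V × Bool)) :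
    ℝ≥0∞ :=
  ∑ a, (stepAcc p q M s a * φ (s ++ [(a, false)]) + stepRej p q M s a * φ (s ++ [(a, true)]))

lemma expect_draft_succ (p : List V → PMF V) (k : ℕ) (x : List V) (φ : List V → ℝ≥0∞) :
    expect (draft p (k + 1) x) φ =
      ∑ a, p x a * expect (draft p k (x ++ [a])) fun l => φ (a :: l) := by
  simp only [draft, expect_bind, expect_pure, expect_eq_sum (p x)]

/-- `G` is the value of whatever follows once this response is finished. That happens at a rejection
or at the horizon, so `hG` is needed only there. After an acceptance the untested tokens are still
an unconditioned draft from the longer context, hence the induction. -/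
lemma expect_draft_verifyTail (p q : List V → PMF V) (M T : ℕ) (φ G : List (V × Bool) → ℝ≥0∞)
    (k : ℕ) (s : List (V × Bool)) (hs : ¬ Fresh s) (hk : s.length + k = T)
    (hG : ∀ (j : ℕ) (s' : List (V × Bool)), s.length ≤ s'.length → s'.length + j = T →
      (Fresh s' ∨ j = 0) → G s' = (step p q M)^[j] φ s') :
    expect (draft p k (s.map Prod.fst)) (fun l =>
      expect (verifyTail p q (s.map Prod.fst) l) fun o => G (s ++ o)) =
      (step p q M)^[k] φ s := by
  induction k generalizing s with
  | zero => simp [draft, expect_pure, verifyTail, hG 0 s le_rfl hk (Or.inr rfl)]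
  | succ k ih =>
    have hacc : ∀ a, expect (draft p k (s.map Prod.fst ++ [a])) (fun l =>
        expect (verifyTail p q (s.map Prod.fst ++ [a]) l) fun o => G (s ++ (a, false) :: o)) =
        (step p q M)^[k] φ (s ++ [(a, false)]) := by
      intro a
      rw [← ih (s ++ [(a, false)]) (by simp [fresh_concat]) (by simp; omega)
        fun j s' h => hG j s' (by simp at h; omega)]
      simp
    have hrej : ∀ a, G (s ++ [(a, true)]) = (step p q M)^[k] φ (s ++ [(a, true)]) := fun a =>
      hG k _ (by simp) (by simp; omega) (Or.inl ((fresh_concat _ _ _).2 rfl))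
    simp only [expect_draft_succ, verifyTail, expect_bind, expect_acceptCoin, if_true,
      Bool.false_eq_true, if_false, expect_pure, expect_add, expect_const_mul, expect_const, hacc,
      sum_test, hrej]
    rw [Function.iterate_succ_apply', step, expect_eq_sum, Finset.mul_sum, ← Finset.sum_add_distrib]
    simp only [← mul_assoc, gap_mul_residual, stepAcc, stepRej, if_neg hs]

/-- Once a first token is accepted, the remaining responses are never read and integrate to one. -/
lemma expect_draftBatch_verifyBatch (p q : List V → PMF V) (k : ℕ) (x : List V)
    (g : List (V × Bool) → ℝ≥0∞) (φ : V → ℝ≥0∞)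
    (hφ : ∀ a, expect (draft p k (x ++ [a])) (fun l =>
      expect (verifyTail p q (x ++ [a]) l) fun o => g ((a, false) :: o)) = φ a)
    (M : ℕ) (r : PMF V) :
    expect (draftBatch p (k + 1) x M) (fun ds => expect (verifyBatch p q x r ds) g) =
      ∑ a, (rootAcc (p x) M r a * φ a + rootRej (p x) M r a * g [(a, true)]) := by
  induction M generalizing r with
  | zero =>
    simp [draftBatch, expect_pure, verifyBatch, expect_bind, expect_eq_sum r, rootAcc, rootRej]
  | succ M ih =>
    simp only [draftBatch, expect_bind, expect_pure, expect_draft_succ, verifyBatch,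
      expect_acceptCoin, if_true, Bool.false_eq_true, if_false, expect_add, expect_const_mul,
      expect_const, ih, hφ, sum_test]
    simp only [Finset.mul_sum, ← Finset.sum_add_distrib, rootAcc, rootRej]
    refine Finset.sum_congr rfl fun a _ => ?_
    ring

/-- With `j` tokens missing, any `K ≥ j` passes suffice: each pass adds a token, and passes at the
horizon are idle. The induction hypothesis supplies the continuation `G` of
`expect_draft_verifyTail`. -/
lemma expect_passes (p q : List V → PMF V) (M T : ℕ) (φ : List (V × Bool) → ℝ≥0∞) (K j : ℕ)
    (s : List (V × Bool)) (hj : s.length + j = T) (hjK : j ≤ K) (hs : Fresh s ∨ j = 0) :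
    expect (passes p q M T K s) φ = (step p q M)^[j] φ s := by
  induction K generalizing j s with
  | zero =>
    obtain rfl : j = 0 := by omega
    simp [passes, expect_pure]
  | succ K ih =>
    rcases j with _ | j
    · have hp : pass p q M T s = PMF.pure s := by
        rw [pass, if_neg (by omega)]
      rw [passes, hp, PMF.pure_bind]
      exact ih 0 s hj (by omega) (Or.inr rfl)
    · have hfresh : Fresh s := by simpa using hs
      have hlen : T - s.length = j + 1 := by omega
      rw [passes, pass, if_pos (by omega), hlen]
      simp only [expect_bind, expect_pure]
      rw [expect_draftBatch_verifyBatch p q j (s.map Prod.fst) _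
        (fun a => (step p q M)^[j] φ (s ++ [(a, false)]))]
      · rw [Function.iterate_succ_apply', step]
        refine Finset.sum_congr rfl fun a _ => ?_
        rw [ih j (s ++ [(a, true)]) (by simp; omega) (by omega)
          (Or.inl ((fresh_concat _ _ _).2 rfl)), stepAcc, stepRej, if_pos hfresh, if_pos hfresh]
      · intro a
        rw [← expect_draft_verifyTail p q M T φ (fun s' => expect (passes p q M T K s') φ) j
          (s ++ [(a, false)]) (by simp [fresh_concat]) (by simp; omega)]
        · simp
        · intro i s' h1 h2 h3
          exact ih i s' h2 (by simp at h1; omega) h3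

lemma expect_law (p q : List V → PMF V) (M T : ℕ) (φ : List (V × Bool) → ℝ≥0∞) :
    expect (law p q M T) φ = (step p q M)^[T] φ [] :=
  expect_passes p q M T φ T T [] (by simp) le_rfl (Or.inl fresh_nil)

/-! ### Iterates of the transition operator. -/

section Iterate

variable (p q : List V → PMF V) (M : ℕ)

lemma iterate_step_congr (φ ψ : List (V × Bool) → ℝ≥0∞) (n : ℕ) (s : List (V × Bool))
    (h : ∀ t, t.length = s.length + n → φ t = ψ t) :
    (step p q M)^[n] φ s = (step p q M)^[n] ψ s := by
  induction n generalizing s with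
  | zero => exact h s rfl
  | succ n ih =>
    have ha : ∀ a b, (step p q M)^[n] φ (s ++ [(a, b)]) = (step p q M)^[n] ψ (s ++ [(a, b)]) :=
      fun a b => ih _ fun t ht => h t (by simp at ht; omega)
    simp only [Function.iterate_succ_apply', step, ha]

lemma iterate_step_add (φ ψ : List (V × Bool) → ℝ≥0∞) (n : ℕ) (s : List (V × Bool)) :
    (step p q M)^[n] (fun t => φ t + ψ t) s = (step p q M)^[n] φ s + (step p q M)^[n] ψ s := by
  induction n generalizing s with
  | zero => rfl
  | succ n ih =>
    simp only [Function.iterate_succ_apply', step, ih, ← Finset.sum_add_distrib]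
    exact Finset.sum_congr rfl fun a _ => by ring

lemma iterate_step_mul_const (φ : List (V × Bool) → ℝ≥0∞) (c : ℝ≥0∞) (n : ℕ)
    (s : List (V × Bool)) :
    (step p q M)^[n] (fun t => φ t * c) s = (step p q M)^[n] φ s * c := by
  induction n generalizing s with
  | zero => rfl
  | succ n ih =>
    simp only [Function.iterate_succ_apply', step, ih, Finset.sum_mul]
    exact Finset.sum_congr rfl fun a _ => by ring

lemma iterate_step_eq_of_forall_append (φ : List (V × Bool) → ℝ≥0∞) (c : ℝ≥0∞) (n : ℕ)
    (s : List (V × Bool)) (h : ∀ t, φ (s ++ t) = c) : (step p q M)^[n] φ s = c := by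
  induction n generalizing s with
  | zero => simpa using h []
  | succ n ih =>
    have ha : ∀ a b, (step p q M)^[n] φ (s ++ [(a, b)]) = c :=
      fun a b => ih _ fun t => by simpa using h ((a, b) :: t)
    simp only [Function.iterate_succ_apply', step, ha, ← add_mul, stepAcc_add_stepRej,
      ← Finset.sum_mul, sum_pmf, one_mul]

lemma iterate_step_sum {ι : Type*} (I : Finset ι) (φ : ι → List (V × Bool) → ℝ≥0∞) (n : ℕ)
    (s : List (V × Bool)) :
    (step p q M)^[n] (fun t => ∑ i ∈ I, φ i t) s = ∑ i ∈ I, (step p q M)^[n] (φ i) s := by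
  classical
  induction I using Finset.induction_on with
  | empty => simpa using iterate_step_eq_of_forall_append p q M (fun _ => 0) 0 n s fun _ => rfl
  | insert i I hi ih => simp only [Finset.sum_insert hi, iterate_step_add, ih]

lemma iterate_step_take (φ : List (V × Bool) → ℝ≥0∞) {n T : ℕ} (h : n ≤ T) :
    (step p q M)^[T] (fun t => φ (t.take n)) [] = (step p q M)^[n] φ [] := by
  obtain ⟨m, rfl⟩ := Nat.exists_eq_add_of_le h
  rw [Function.iterate_add_apply]
  refine iterate_step_congr p q M _ _ n [] fun t ht => ?_
  refine iterate_step_eq_of_forall_append p q M _ _ m t fun u => ?_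
  have : t.length = n := by simpa using ht
  simp [← this]

end Iterate

/-! ### Prefix probabilities and their recursion. -/

open Classical in
/-- The indicator of the states with tokens `x` whose last token is rejected. -/
def rejInd (x : List V) (s : List (V × Bool)) : ℝ≥0∞ :=
  if s.map Prod.fst = x ∧ Fresh s then 1 else 0

open Classical in
/-- The indicator of the states with tokens `x` whose last token is accepted. -/
def accInd (x : List V) (s : List (V × Bool)) : ℝ≥0∞ :=
  if s.map Prod.fst = x ∧ ¬ Fresh s then 1 else 0

variable (p q : List V → PMF V) (M : ℕ)

/-- The probability that the first tokens are `x` and the last of them is rejected. -/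
def rejProb (x : List V) : ℝ≥0∞ := (step p q M)^[x.length] (rejInd x) []

/-- The probability that the first tokens are `x` and the last of them is accepted. -/
def accProb (x : List V) : ℝ≥0∞ := (step p q M)^[x.length] (accInd x) []

lemma step_rejInd (x : List V) (a : V) (s : List (V × Bool)) :
    step p q M (rejInd (x ++ [a])) s =
      rejInd x s * rootRej (p x) M (q x) a + accInd x s * (q x a - p x a) := by
  rw [step, Finset.sum_eq_single a]
  · by_cases hx : s.map Prod.fst = x
    · subst hx
      by_cases hs : Fresh s <;> simp [rejInd, accInd, stepRej, fresh_concat, hs]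
    · simp [rejInd, accInd, hx, fresh_concat]
  · intro b _ hb
    simp [rejInd, hb]
  · simp

lemma step_accInd (x : List V) (a : V) (s : List (V × Bool)) :
    step p q M (accInd (x ++ [a])) s =
      rejInd x s * rootAcc (p x) M (q x) a + accInd x s * min (p x a) (q x a) := by
  rw [step, Finset.sum_eq_single a]
  · by_cases hx : s.map Prod.fst = x
    · subst hx
      by_cases hs : Fresh s <;> simp [rejInd, accInd, stepAcc, fresh_concat, hs]
    · simp [rejInd, accInd, hx, fresh_concat]
  · intro b _ hb
    simp [accInd, hb]
  · simp

lemma rejProb_nil : rejProb p q M [] = 1 := by simp [rejProb, rejInd, fresh_nil]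

lemma accProb_nil : accProb p q M [] = 0 := by simp [accProb, accInd, fresh_nil]

lemma rejProb_concat (x : List V) (a : V) :
    rejProb p q M (x ++ [a]) =
      rejProb p q M x * rootRej (p x) M (q x) a + accProb p q M x * (q x a - p x a) := by
  rw [rejProb, List.length_append, List.length_singleton, Function.iterate_succ_apply,
    funext (step_rejInd p q M x a), iterate_step_add, iterate_step_mul_const,
    iterate_step_mul_const]
  rfl

lemma accProb_concat (x : List V) (a : V) :
    accProb p q M (x ++ [a]) =
      rejProb p q M x * rootAcc (p x) M (q x) a + accProb p q M x * min (p x a) (q x a) := by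
  rw [accProb, List.length_append, List.length_singleton, Function.iterate_succ_apply,
    funext (step_accInd p q M x a), iterate_step_add, iterate_step_mul_const,
    iterate_step_mul_const]
  rfl

omit [Fintype V] in
lemma condProb_concat (c x : List V) (a : V) :
    condProb q c (x ++ [a]) = condProb q c x * (q (c ++ x) a).toReal := by
  induction x generalizing c with
  | nil => simp [condProb]
  | cons b x ih => simp [condProb, ih, mul_assoc]

omit [Fintype V] in
lemma jointProb_concat (x : List V) (a : V) :
    jointProb q (x ++ [a]) = jointProb q x * (q x a).toReal := by
  simp [jointProb, condProb_concat]

omit [Fintype V] in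
lemma jointProb_nonneg (x : List V) : 0 ≤ jointProb q x := by
  induction x using List.reverseRecOn with
  | nil => simp [jointProb, condProb]
  | append_singleton x a ih =>
    rw [jointProb_concat]
    positivity

/-- The tokens of the decoding are distributed according to the target model. -/
lemma rejProb_add_accProb (x : List V) :
    rejProb p q M x + accProb p q M x = ENNReal.ofReal (jointProb q x) := by
  induction x using List.reverseRecOn with
  | nil => simp [rejProb_nil, accProb_nil, jointProb, condProb]
  | append_singleton x a ih =>
    rw [jointProb_concat, ENNReal.ofReal_mul (jointProb_nonneg q x), ← ih,
      ENNReal.ofReal_toReal ((q x).apply_ne_top a), rejProb_concat, accProb_concat, add_mul]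
    -- The factor `q x a` is split differently in the two terms: by the batch tests after a
    -- rejection, by a single test after an acceptance.
    conv_rhs =>
      congr
      · rw [← rootAcc_add_rootRej (p x) M (q x) a]
      · rw [← min_add_tsub (p x a) (q x a)]
    ring

lemma rejProb_le (x : List V) : rejProb p q M x ≤ ENNReal.ofReal (jointProb q x) := by
  rw [← rejProb_add_accProb p q M x]
  exact le_self_add

lemma rejProb_ne_top (x : List V) : rejProb p q M x ≠ ∞ :=
  ne_top_of_le_ne_top ENNReal.ofReal_ne_top (rejProb_le p q M x)

lemma accProb_ne_top (x : List V) : accProb p q M x ≠ ∞ := by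
  refine ne_top_of_le_ne_top (ENNReal.ofReal_ne_top (r := jointProb q x)) ?_
  rw [← rejProb_add_accProb p q M x]
  exact le_add_self

lemma toReal_accProb (x : List V) :
    (accProb p q M x).toReal = jointProb q x - (rejProb p q M x).toReal := by
  rw [eq_sub_iff_add_eq', ← ENNReal.toReal_add (rejProb_ne_top p q M x) (accProb_ne_top p q M x),
    rejProb_add_accProb, ENNReal.toReal_ofReal (jointProb_nonneg q x)]

omit [Fintype V] in
lemma toReal_tsub_eq_excess (x : List V) (a : V) :
    (q x a - p x a).toReal = excess p q x a := by
  rw [excess]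
  rcases le_total (p x a) (q x a) with h | h
  · rw [ENNReal.toReal_sub_of_le h ((q x).apply_ne_top a), max_eq_right]
    exact sub_nonneg.2 (ENNReal.toReal_mono ((q x).apply_ne_top a) h)
  · rw [tsub_eq_zero_of_le h, max_eq_left, ENNReal.toReal_zero]
    exact sub_nonpos.2 (ENNReal.toReal_mono ((p x).apply_ne_top a) h)

/-! ### The rejection masses `f^M`. -/

lemma rejMass_eq_expect (T : ℕ) (x : List V) :
    rejMass p q T M x = (expect (law p q M T) fun s => rejInd x (s.take x.length)).toReal := by
  classical
  rw [rejMass, PMF.toOuterMeasure_apply, expect]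
  congr 2
  ext s
  by_cases h : s ∈ {s : List (V × Bool) | (s.take x.length).map Prod.fst = x ∧
      ∀ b ∈ (s.take x.length).getLast?, b.2 = true}
  · rw [Set.indicator_of_mem h, rejInd, if_pos (by exact h), mul_one]
  · rw [Set.indicator_of_notMem h, rejInd, if_neg (by exact h), mul_zero]

lemma rejMass_of_le (T : ℕ) (x : List V) (h : x.length ≤ T) :
    rejMass p q T M x = (rejProb p q M x).toReal := by
  rw [rejMass_eq_expect, expect_law, iterate_step_take p q M (rejInd x) h, rejProb]

lemma rejMass_of_lt (T : ℕ) (x : List V) (h : T < x.length) : rejMass p q T M x = 0 := by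
  rw [rejMass_eq_expect, expect_law, iterate_step_congr p q M _ (fun _ => 0) T [],
    iterate_step_eq_of_forall_append p q M (fun _ => 0) 0 T [] fun _ => rfl, ENNReal.toReal_zero]
  intro t ht
  refine if_neg fun hx => ?_
  have := congrArg List.length hx.1
  simp at this ht
  omega

lemma rejMass_nil (T : ℕ) : rejMass p q T M [] = 1 := by
  rw [rejMass_of_le p q M T [] (by simp), rejProb_nil, ENNReal.toReal_one]

lemma rejMass_le (T : ℕ) (x : List V) : rejMass p q T M x ≤ jointProb q x := by
  rcases le_or_gt x.length T with h | h
  · rw [rejMass_of_le p q M T x h]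
    exact ENNReal.toReal_le_of_le_ofReal (jointProb_nonneg q x) (rejProb_le p q M x)
  · rw [rejMass_of_lt p q M T x h]
    exact jointProb_nonneg q x

lemma rejMass_concat (T : ℕ) (x : List V) (a : V) (h : x.length < T) :
    rejMass p q T M (x ++ [a]) = rejMass p q T M x * (rootRej (p x) M (q x) a).toReal +
      (jointProb q x - rejMass p q T M x) * excess p q x a := by
  rw [rejMass_of_le p q M T _ (by simpa using h), rejMass_of_le p q M T x h.le, rejProb_concat,
    ENNReal.toReal_add, ENNReal.toReal_mul, ENNReal.toReal_mul, toReal_accProb,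
    toReal_tsub_eq_excess]
  · exact ENNReal.mul_ne_top (rejProb_ne_top p q M x) (rootRej_ne_top _ _ _ _)
  · exact ENNReal.mul_ne_top (accProb_ne_top p q M x)
      (ne_top_of_le_ne_top ((q x).apply_ne_top a) tsub_le_self)

/-! ### The expected number of rejections. -/

open Classical in
/-- The indicator of the states whose last token is rejected. -/
def freshInd (s : List (V × Bool)) : ℝ≥0∞ := if Fresh s then 1 else 0

lemma iterate_step_freshInd (n : ℕ) :
    (step p q M)^[n] freshInd [] = ∑ x : Fin n → V, rejProb p q M (List.ofFn x) := by
  classical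
  simp only [rejProb, List.length_ofFn]
  rw [← iterate_step_sum]
  refine iterate_step_congr p q M _ _ n [] fun t ht => ?_
  obtain rfl : t.length = n := by simpa using ht
  have hget : List.ofFn (fun i => (t.get i).1) = t.map Prod.fst := by
    conv_rhs => rw [← List.ofFn_get t, List.map_ofFn]
    rfl
  rw [Finset.sum_eq_single fun i => (t.get i).1]
  · simp [freshInd, rejInd]
  · intro x _ hx
    refine if_neg fun h => hx ?_
    exact List.ofFn_injective (hget.trans h.1).symm
  · simp

lemma iterate_step_countP (n : ℕ) :
    (step p q M)^[n] (fun s => ((s.countP Prod.snd : ℝ≥0∞) : ℝ≥0∞)) [] =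
      ∑ k ∈ Finset.range n, ∑ x : Fin (k + 1) → V, rejProb p q M (List.ofFn x) := by
  induction n with
  | zero => simp
  | succ n ih =>
    -- One step adds to the count the probability that the new token is rejected.
    have hstep : step p q M (fun s => ((s.countP Prod.snd : ℝ≥0∞) : ℝ≥0∞)) =
        fun s => (s.countP Prod.snd : ℝ≥0∞) + step p q M freshInd s := by
      funext s
      have hs : (s.countP Prod.snd : ℝ≥0∞) =
          ∑ a, (stepAcc p q M s a + stepRej p q M s a) * (s.countP Prod.snd : ℝ≥0∞) := by
        simp only [stepAcc_add_stepRej, ← Finset.sum_mul, sum_pmf, one_mul]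
      rw [hs, step, step, ← Finset.sum_add_distrib]
      refine Finset.sum_congr rfl fun a _ => ?_
      simp [freshInd, fresh_concat, List.countP_append]
      ring
    rw [Function.iterate_succ_apply, hstep, iterate_step_add, ih, Finset.sum_range_succ,
      ← Function.iterate_succ_apply, iterate_step_freshInd]

lemma expectedRejections_eq (T : ℕ) :
    expectedRejections p q M T =
      ∑ k ∈ Finset.range T, ∑ x : Fin (k + 1) → V, rejMass p q T M (List.ofFn x) := by
  have h := expect_law p q M T fun s => (s.countP Prod.snd : ℝ≥0∞)
  have hfin : ∀ k, ∑ x : Fin (k + 1) → V, rejProb p q M (List.ofFn x) ≠ ∞ := fun k =>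
    ENNReal.sum_ne_top.2 fun x _ => rejProb_ne_top p q M _
  rw [iterate_step_countP, expect] at h
  rw [expectedRejections, h, ENNReal.toReal_sum fun k _ => hfin k]
  refine Finset.sum_congr rfl fun k hk => ?_
  rw [ENNReal.toReal_sum fun x _ => rejProb_ne_top p q M _]
  refine Finset.sum_congr rfl fun x _ => ?_
  rw [rejMass_of_le]
  simpa using hk

lemma sum_excess (x : List V) : ∑ a, excess p q x a = tv (q x) (p x) := by
  have hsum : ∀ r : PMF V, ∑ a, (r a).toReal = 1 := fun r => by
    rw [← ENNReal.toReal_sum fun a _ => r.apply_ne_top a, sum_pmf, ENNReal.toReal_one]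
  have hmax : ∀ a, excess p q x a =
      1 / 2 * (|(q x a).toReal - (p x a).toReal| + ((q x a).toReal - (p x a).toReal)) := by
    intro a
    rw [excess]
    rcases le_total 0 ((q x a).toReal - (p x a).toReal) with h | h
    · rw [max_eq_right h, abs_of_nonneg h]
      ring
    · rw [max_eq_left h, abs_of_nonpos h]
      ring
  simp only [hmax, ← Finset.mul_sum, Finset.sum_add_distrib, Finset.sum_sub_distrib, hsum, tv]
  ring

lemma eq_of_tv_eq_zero (r s : PMF V) (h : tv r s = 0) : r = s := by
  have h0 : ∑ a, |(r a).toReal - (s a).toReal| = 0 := by simpa [tv] using h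
  ext a
  have := (Finset.sum_eq_zero_iff_of_nonneg fun a _ => abs_nonneg _).1 h0 a (Finset.mem_univ a)
  exact (ENNReal.toReal_eq_toReal_iff' (r.apply_ne_top a) (s.apply_ne_top a)).1
    (sub_eq_zero.1 (abs_eq_zero.1 this))

lemma sum_ofFn_succ (k : ℕ) (g : List V → ℝ) :
    ∑ x : Fin (k + 1) → V, g (List.ofFn x) = ∑ x : Fin k → V, ∑ a, g (List.ofFn x ++ [a]) := by
  rw [← (Fin.snocEquiv fun _ : Fin (k + 1) => V).sum_comp, Fintype.sum_prod_type,
    Finset.sum_comm]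
  simp only [Fin.snocEquiv, Equiv.coe_fn_mk, List.ofFn_succ', Fin.snoc_castSucc, Fin.snoc_last,
    List.concat_eq_append]

/-! ### Limits for large batches. -/

lemma exists_tendsto_rootRej (r s : PMF V) (a : V) :
    ∃ l : ℝ, Tendsto (fun M => (rootRej s M r a).toReal) atTop (𝓝 l) :=
  ⟨_, tendsto_atTop_ciInf
    (antitone_nat_of_succ_le fun M =>
      ENNReal.toReal_mono (rootRej_ne_top s M r a) (rootRej_succ_le s M r a))
    ⟨0, by rintro _ ⟨M, rfl⟩; exact ENNReal.toReal_nonneg⟩⟩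

/-- With many responses, a token which the draft model can produce is rarely a replacement. -/
lemma tendsto_rootRej_zero (r s : PMF V) (a : V) (h : r a ≠ 0 → s a ≠ 0) :
    Tendsto (fun M => (rootRej s M r a).toReal) atTop (𝓝 0) := by
  rw [← ENNReal.toReal_zero]
  refine (ENNReal.tendsto_toReal ENNReal.zero_ne_top).comp ?_
  by_cases hs : s a = 0
  · have h0 : ∀ M, rootRej s M r a = 0 := fun M =>
      le_antisymm ((rootRej_le s M r a).trans_eq (by_contra fun hr => h hr hs)) zero_le
    simp [h0]
  · exact tendsto_of_tendsto_of_tendsto_of_le_of_le tendsto_const_nhds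
      (ENNReal.tendsto_pow_atTop_nhds_zero_of_lt_one
        (ENNReal.sub_lt_self ENNReal.one_ne_top one_ne_zero hs))
      (fun _ => zero_le) (fun M => rootRej_le_pow s M r a)

lemma exists_tendsto_rejMass (T : ℕ) (x : List V) :
    ∃ l : ℝ, Tendsto (fun M => rejMass p q T M x) atTop (𝓝 l) := by
  induction x using List.reverseRecOn with
  | nil => exact ⟨1, by simp [rejMass_nil]⟩
  | append_singleton x a ih =>
    rcases lt_or_ge x.length T with h | h
    · obtain ⟨l, hl⟩ := ih
      obtain ⟨R, hR⟩ := exists_tendsto_rootRej (q x) (p x) a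
      simp only [rejMass_concat p q _ T x a h]
      exact ⟨_, (hl.mul hR).add ((hl.const_sub _).mul_const _)⟩
    · exact ⟨0, by simp [rejMass_of_lt p q _ T (x ++ [a]) (by simp; omega)]⟩

end BatchSD

end

theorem mainTheorem6 {V : Type*} [Fintype V] (p q : List V → PMF V) (T : ℕ) :
    (∀ (M : ℕ) (x : List V), BatchSD.rejMass p q T M x ≤ BatchSD.jointProb q x) ∧
    ∃ fInf : List V → ℝ,
      (∀ x : List V, Tendsto (fun M : ℕ => BatchSD.rejMass p q T M x) atTop (𝓝 (fInf x))) ∧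
      (∀ x : List V, fInf x ≤ BatchSD.jointProb q x) ∧
      ((∀ (x : List V) (a : V), x.length < T → 0 < BatchSD.jointProb q x →
          q x a ≠ 0 → p x a ≠ 0) →
        (∀ (x : List V) (a : V), x.length < T →
          fInf (x ++ [a]) = BatchSD.excess p q x a * (BatchSD.jointProb q x - fInf x)) ∧
        Tendsto (fun M : ℕ => BatchSD.expectedRejections p q M T) atTop
          (𝓝 (∑ k ∈ Finset.range T,
            (BatchSD.pseudoExp (BatchSD.jointProb q) k (fun x => BatchSD.tv (q x) (p x)) -
              BatchSD.pseudoExp fInf k (fun x => BatchSD.tv (q x) (p x)))))) ∧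
      ((∃ x : List V, 1 ≤ x.length ∧ x.length < T ∧ 0 < BatchSD.jointProb q x ∧ p x ≠ q x) →
        ¬ Tendsto (fun M : ℕ => BatchSD.expectedRejections p q M T) atTop (𝓝 0)) := by
  refine ⟨fun M x => BatchSD.rejMass_le p q M T x, ?_⟩
  choose fInf hf using BatchSD.exists_tendsto_rejMass p q T
  have hle : ∀ x, fInf x ≤ BatchSD.jointProb q x := fun x =>
    le_of_tendsto' (hf x) fun M => BatchSD.rejMass_le p q M T x
  have hnonneg : ∀ x, 0 ≤ fInf x := fun x =>
    ge_of_tendsto' (hf x) fun M => ENNReal.toReal_nonneg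
  have hrec : ∀ (x : List V) (a : V) (R : ℝ), x.length < T →
      Tendsto (fun M => (BatchSD.rootRej (p x) M (q x) a).toReal) atTop (𝓝 R) →
      fInf (x ++ [a]) =
        fInf x * R + (BatchSD.jointProb q x - fInf x) * BatchSD.excess p q x a := by
    intro x a R hx hR
    refine tendsto_nhds_unique (hf _) ?_
    simp only [BatchSD.rejMass_concat p q _ T x a hx]
    exact ((hf x).mul hR).add (((hf x).const_sub _).mul_const _)
  have hE : Tendsto (fun M : ℕ => BatchSD.expectedRejections p q M T) atTop
      (𝓝 (∑ k ∈ Finset.range T, ∑ x : Fin (k + 1) → V, fInf (List.ofFn x))) := by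
    simp only [BatchSD.expectedRejections_eq]
    exact tendsto_finsetSum _ fun k _ => tendsto_finsetSum _ fun x _ => hf _
  refine ⟨fInf, hf, hle, fun hcov => ?_, ?_⟩
  · have hrec' : ∀ (x : List V) (a : V), x.length < T →
        fInf (x ++ [a]) = BatchSD.excess p q x a * (BatchSD.jointProb q x - fInf x) := by
      intro x a hx
      rcases (BatchSD.jointProb_nonneg q x).eq_or_lt with h0 | h0
      -- Covering says nothing at a context of target probability zero, but there `fInf x` is
      -- squeezed to `0` and the value of `R` is irrelevant.
      · obtain ⟨R, hR⟩ := BatchSD.exists_tendsto_rootRej (q x) (p x) a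
        have hfx : fInf x = 0 := le_antisymm (h0 ▸ hle x) (hnonneg x)
        rw [hrec x a R hx hR, hfx]
        ring
      · rw [hrec x a 0 hx (BatchSD.tendsto_rootRej_zero (q x) (p x) a (hcov x a hx h0))]
        ring
    refine ⟨hrec', ?_⟩
    convert hE using 3 with k hk
    rw [BatchSD.sum_ofFn_succ, BatchSD.pseudoExp, BatchSD.pseudoExp, ← Finset.sum_sub_distrib]
    refine Finset.sum_congr rfl fun x _ => ?_
    rw [Finset.sum_congr rfl fun a _ => hrec' (List.ofFn x) a (by simpa using hk),
      ← Finset.sum_mul, BatchSD.sum_excess]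
    ring
  · rintro ⟨x, hx1, hxT, hq, hpq⟩ h0
    have hsum := tendsto_nhds_unique hE h0
    -- A vanishing sum of nonnegative limits vanishes termwise. The sum starts at length one, so the
    -- empty prefix, where `fInf` is `1`, is excluded.
    have hzero : ∀ y : List V, 1 ≤ y.length → y.length ≤ T → fInf y = 0 := by
      intro y hy1 hyT
      obtain ⟨k, hk⟩ := Nat.exists_eq_add_of_le' hy1
      have h1 := (Finset.sum_eq_zero_iff_of_nonneg fun k _ =>
        Finset.sum_nonneg fun x _ => hnonneg _).1 hsum k (Finset.mem_range.2 (by omega))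
      rw [← hk] at h1
      have h2 := (Finset.sum_eq_zero_iff_of_nonneg fun x _ => hnonneg _).1 h1 y.get
        (Finset.mem_univ _)
      rwa [List.ofFn_get] at h2
    refine hpq (BatchSD.eq_of_tv_eq_zero _ _ ?_).symm
    rw [← BatchSD.sum_excess]
    refine Finset.sum_eq_zero fun a _ => ?_
    obtain ⟨R, hR⟩ := BatchSD.exists_tendsto_rootRej (q x) (p x) a
    have h := hrec x a R hxT hR
    rw [hzero x hx1 hxT.le, hzero (x ++ [a]) (by simp) (by simpa using hxT)] at h
    simpa [hq.ne'] using h
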